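/- Let $\mathbb{K}$ be a field of characteristic $0$, $V$ a $\mathbb{K}$-vector space, and $T(V)=\bigoplus_{n\ge 0}T_n(V)$, $T_n(V)=V^{\otimes n}$, whose elements $v_1\otimes\cdots\otimes v_n$ are written as words $v_1\ldots v_n$; let $1$ be the empty word. Equip $T(V)$ with the deconcatenation coproduct $\Delta(v_1\ldots v_n)=\sum_{i=0}^n v_1\ldots v_i\otimes v_{i+1}\ldots v_n$ and with the counit given by the projection onto $V^{\otimes 0}=\mathbb{K}$, and let $T_+(V)=\bigoplus_{n\ge1}T_n(V)$ be the kernel of the counit. Let $*$ be a commutative $B_\infty$ product on $T(V)$, i.e. a commutative associative product with unit $1$ such that $(T(V),*,\Delta)$ is a bialgebra. Let $e_*$ be the linear endomorphism of $T(V)$ with $e_*(1)=0$ and, for every word $w$ of length $n\ge 1$, \[e_*(w)=\sum_{k=1}^n\ \sum_{\substack{w=w_1\ldots w_k\\ w_1,\ldots,w_k\neq\emptyset}}\frac{(-1)^{k-1}}{k}\,w_1*\cdots*w_k ,\] where the inner sum is over the decompositions of $w$ as a concatenation of $k$ non-empty words. Then: 1. $e_*$ is a projector: $e_*\circ e_*=e_*$.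 2. $e_*$ vanishes on $T_+(V)*T_+(V)$ (the span of the products of two elements of $T_+(V)$), and $e_*(v)=v$ for every $v\in V$. Moreover $e_*$ is a tangent to identity infinitesimal endomorphism of $(T(V),*,\Delta)$: it vanishes on $\mathbb{K}+T_+(V)*T_+(V)$ and is the identity on the space of primitive elements $\{x\in T_+(V) : \Delta(x)=x\otimes 1+1\otimes x\}$. 3. The image of $e_*$ freely generates $(T(V),*)$ as a commutative algebra: the algebra morphism from the symmetric algebra of $\mathrm{Im}(e_*)$ to $(T(V),*)$ that extends the inclusion is an isomorphism. 4. For every $n\ge 0$, $e_*(T_n(V))\subseteq\bigoplus_{k=1}^n T_k(V)$ (which is $0$ for $n=0$). -/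

import Mathlib

open scoped TensorProduct

noncomputable section

namespace BInfinity

section Deconcatenation

variable (K : Type*) [Field K] (V : Type*) [AddCommGroup V] [Module K V]

/-- The word `v₁ ⋯ vₙ = v₁ ⊗ ⋯ ⊗ vₙ` of `T(V)`, for a list of letters `[v₁, …, vₙ]`. The space
`T(V)` is `TensorAlgebra K V`; its multiplication in Mathlib is the concatenation of words. -/
def word {V : Type*} [AddCommGroup V] [Module K V] (l : List V) : TensorAlgebra K V :=
  (l.map (TensorAlgebra.ι K)).prod

/-- The homogeneous component `T_n(V) = V^{⊗n}` of `T(V)`, spanned by the words of length `n`. -/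
def component (n : ℕ) : Submodule K (TensorAlgebra K V) :=
  LinearMap.range (TensorAlgebra.ι K : V →ₗ[K] TensorAlgebra K V) ^ n

/-- The counit: the canonical projection of `T(V)` on `V^{⊗0} = K`. -/
def counit : TensorAlgebra K V →ₗ[K] K :=
  (TensorAlgebra.algebraMapInv : TensorAlgebra K V →ₐ[K] K).toLinearMap

/-- The augmentation subspace `T₊(V)`, the kernel of the counit. -/
def augmentation : Submodule K (TensorAlgebra K V) :=
  LinearMap.ker (counit K V)

/-- Prefixing a letter: the operator `(x, w) ↦ ((v ⊗ 1) x + 1 ⊗ v w, v w)` on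
`(T(V) ⊗ T(V)) × T(V)`, as a linear function of `v`. If `x` is the deconcatenation of `w`, then
`(v ⊗ 1) x + 1 ⊗ v w` is the deconcatenation of `v w`. -/
def prefixLetter : V →ₗ[K] Module.End K
    ((TensorAlgebra K V ⊗[K] TensorAlgebra K V) × TensorAlgebra K V) where
  toFun v := LinearMap.prod
    (LinearMap.mulLeft K (TensorAlgebra.ι K v ⊗ₜ[K] (1 : TensorAlgebra K V)) ∘ₗ
        LinearMap.fst K _ _ +
      TensorProduct.mk K (TensorAlgebra K V) (TensorAlgebra K V) 1 ∘ₗ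
        LinearMap.mulLeft K (TensorAlgebra.ι K v) ∘ₗ LinearMap.snd K _ _)
    (LinearMap.mulLeft K (TensorAlgebra.ι K v) ∘ₗ LinearMap.snd K _ _)
  map_add' u v := by
    refine LinearMap.ext fun p => ?_
    ext
    · simp [TensorProduct.add_tmul, TensorProduct.tmul_add, add_mul]
      abel
    · simp [add_mul]
  map_smul' r v := by
    refine LinearMap.ext fun p => ?_
    ext
    · simp [← TensorProduct.smul_tmul']
    · simp

/-- The deconcatenation coproduct
`Δ(v₁ ⋯ vₙ) = ∑_{i=0}^{n} v₁ ⋯ vᵢ ⊗ vᵢ₊₁ ⋯ vₙ` (see `comul_word`). -/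
def comul : TensorAlgebra K V →ₗ[K] TensorAlgebra K V ⊗[K] TensorAlgebra K V :=
  LinearMap.fst K _ _ ∘ₗ
    LinearMap.applyₗ ((1 : TensorAlgebra K V ⊗[K] TensorAlgebra K V), (1 : TensorAlgebra K V)) ∘ₗ
      (TensorAlgebra.lift K (prefixLetter K V)).toLinearMap

variable {K V}

theorem comul_one : comul K V 1 = 1 ⊗ₜ[K] 1 := by
  simp [comul, Algebra.TensorProduct.one_def]

theorem comul_ι_mul (v : V) (w : TensorAlgebra K V) :
    comul K V (TensorAlgebra.ι K v * w) =
      (TensorAlgebra.ι K v ⊗ₜ[K] 1) * comul K V w + 1 ⊗ₜ[K] (TensorAlgebra.ι K v * w) := by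
  have key : ∀ (x : TensorAlgebra K V)
      (p : (TensorAlgebra K V ⊗[K] TensorAlgebra K V) × TensorAlgebra K V),
      (TensorAlgebra.lift K (prefixLetter K V) x p).2 = x * p.2 := by
    intro x
    induction x using TensorAlgebra.induction with
    | algebraMap r => intro p; simp [Algebra.smul_def]
    | ι v => intro p; simp [prefixLetter]
    | mul a b ha hb => intro p; simp [ha, hb, mul_assoc]
    | add a b ha hb => intro p; simp [ha, hb, add_mul]
  have h2 := key w (1, 1)
  simp only [mul_one] at h2
  have h1 : comul K V (TensorAlgebra.ι K v * w) =
      (prefixLetter K V v (TensorAlgebra.lift K (prefixLetter K V) w (1, 1))).1 := by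
    simp only [comul, LinearMap.comp_apply, AlgHom.toLinearMap_apply,
      LinearMap.applyₗ_apply_apply, LinearMap.fst_apply, map_mul, Module.End.mul_apply,
      TensorAlgebra.lift_ι_apply]
  rw [h1]
  change (TensorAlgebra.ι K v ⊗ₜ[K] 1) * comul K V w +
    1 ⊗ₜ[K] (TensorAlgebra.ι K v * (TensorAlgebra.lift K (prefixLetter K V) w (1, 1)).2) = _
  rw [h2]

theorem word_nil : word K ([] : List V) = 1 := by simp [word]

theorem word_cons (v : V) (l : List V) : word K (v :: l) = TensorAlgebra.ι K v * word K l := by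
  simp [word]

theorem word_ofFn {n : ℕ} (v : Fin n → V) :
    word K (List.ofFn v) = TensorAlgebra.tprod K V n v := by
  simp [word, TensorAlgebra.tprod_apply, List.map_ofFn, Function.comp_def]

/-- The deconcatenation formula. -/
theorem comul_word (l : List V) :
    comul K V (word K l) =
      ∑ i ∈ Finset.range (l.length + 1), word K (l.take i) ⊗ₜ[K] word K (l.drop i) := by
  induction l with
  | nil => simp [word_nil, comul_one]
  | cons v l ih =>
    rw [word_cons, comul_ι_mul, ih, Finset.mul_sum, List.length_cons, Finset.sum_range_succ' _
      (l.length + 1)]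
    simp [word_cons, word_nil]

/-- Two linear maps on `T(V)` agree if they agree on the empty word and agree on `v w` whenever
they agree on `w`. -/
theorem hom_ext_prefix {N : Type*} [AddCommGroup N] [Module K N]
    {f g : TensorAlgebra K V →ₗ[K] N} (h1 : f 1 = g 1)
    (h : ∀ (v : V) (w : TensorAlgebra K V), f w = g w →
      f (TensorAlgebra.ι K v * w) = g (TensorAlgebra.ι K v * w)) : f = g := by
  have key : ∀ x y : TensorAlgebra K V, f y = g y → f (x * y) = g (x * y) := by
    intro x
    induction x using TensorAlgebra.induction with
    | algebraMap r => intro y hy; simp [← Algebra.smul_def, hy]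
    | ι v => exact h v
    | mul a b ha hb => intro y hy; rw [mul_assoc]; exact ha _ (hb _ hy)
    | add a b ha hb => intro y hy; simp [add_mul, ha y hy, hb y hy]
  ext x
  simpa using key x 1 h1

theorem counit_one : counit K V 1 = 1 := by simp [counit]

theorem counit_ι_mul (v : V) (w : TensorAlgebra K V) :
    counit K V (TensorAlgebra.ι K v * w) = 0 := by
  simp [counit, TensorAlgebra.algebraMapInv]

variable (K V)

theorem comul_coassoc :
    (TensorProduct.assoc K (TensorAlgebra K V) (TensorAlgebra K V)
        (TensorAlgebra K V)).toLinearMap ∘ₗ (comul K V).rTensor _ ∘ₗ comul K V =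
      (comul K V).lTensor _ ∘ₗ comul K V := by
  refine hom_ext_prefix (by simp [comul_one]) fun v w hw => ?_
  have hl : ∀ z : TensorAlgebra K V ⊗[K] TensorAlgebra K V,
      (comul K V).lTensor (TensorAlgebra K V) ((TensorAlgebra.ι K v ⊗ₜ[K] 1) * z) =
        (TensorAlgebra.ι K v ⊗ₜ[K] 1) * (comul K V).lTensor (TensorAlgebra K V) z := by
    intro z
    induction z using TensorProduct.induction_on with
    | zero => simp
    | tmul a b => simp
    | add a b ha hb => simp [mul_add, ha, hb]
  have hr : ∀ z : TensorAlgebra K V ⊗[K] TensorAlgebra K V,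
      TensorProduct.assoc K _ _ _
          ((comul K V).rTensor (TensorAlgebra K V) ((TensorAlgebra.ι K v ⊗ₜ[K] 1) * z)) =
        (TensorAlgebra.ι K v ⊗ₜ[K] 1) * TensorProduct.assoc K _ _ _
          ((comul K V).rTensor (TensorAlgebra K V) z) +
        1 ⊗ₜ[K] ((TensorAlgebra.ι K v ⊗ₜ[K] 1) * z) := by
    intro z
    induction z using TensorProduct.induction_on with
    | zero => simp
    | tmul a b =>
      simp only [Algebra.TensorProduct.tmul_mul_tmul, one_mul, LinearMap.rTensor_tmul,
        comul_ι_mul, TensorProduct.add_tmul, map_add, TensorProduct.assoc_tmul, add_left_inj]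
      generalize comul K V a = x
      induction x using TensorProduct.induction_on with
      | zero => simp
      | tmul c d => simp [Algebra.TensorProduct.one_def]
      | add c d hc hd => simp only [mul_add, TensorProduct.add_tmul, map_add, hc, hd]
    | add a b ha hb =>
      simp only [mul_add, map_add, ha, hb, TensorProduct.tmul_add]
      abel
  simp only [LinearMap.comp_apply, LinearEquiv.coe_coe] at hw ⊢
  rw [comul_ι_mul, map_add, map_add, map_add, hl, hr, hw]
  simp [comul_one, comul_ι_mul, TensorProduct.tmul_add, add_assoc]

theorem counit_comul_left :
    (counit K V).rTensor _ ∘ₗ comul K V = TensorProduct.mk K _ _ 1 := by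
  refine hom_ext_prefix (by simp [comul_one, counit_one]) fun v w _ => ?_
  have h : ∀ z : TensorAlgebra K V ⊗[K] TensorAlgebra K V,
      (counit K V).rTensor (TensorAlgebra K V) ((TensorAlgebra.ι K v ⊗ₜ[K] 1) * z) = 0 := by
    intro z
    induction z using TensorProduct.induction_on with
    | zero => simp
    | tmul a b => simp [counit_ι_mul]
    | add a b ha hb => simp [mul_add, ha, hb]
  simp [comul_ι_mul, h, counit_one]

theorem counit_comul_right :
    (counit K V).lTensor _ ∘ₗ comul K V = (TensorProduct.mk K _ _).flip 1 := by
  refine hom_ext_prefix (by simp [comul_one, counit_one]) fun v w hw => ?_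
  have h : ∀ z : TensorAlgebra K V ⊗[K] TensorAlgebra K V,
      (counit K V).lTensor (TensorAlgebra K V) ((TensorAlgebra.ι K v ⊗ₜ[K] 1) * z) =
        LinearMap.rTensor K (LinearMap.mulLeft K (TensorAlgebra.ι K v))
          ((counit K V).lTensor (TensorAlgebra K V) z) := by
    intro z
    induction z using TensorProduct.induction_on with
    | zero => simp
    | tmul a b => simp
    | add a b ha hb => simp [mul_add, ha, hb]
  simp only [LinearMap.comp_apply] at hw
  simp [comul_ι_mul, h, counit_ι_mul, hw]

end Deconcatenation

/-- A commutative `B_∞` product on `T(V)`: a commutative product `*`, with unit the empty word,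
making `T(V)` with the deconcatenation coproduct a bialgebra. In `map_comul`,
`TensorProduct.map₂ mul mul` is the product `(a ⊗ b, c ⊗ d) ↦ (a * c) ⊗ (b * d)`. -/
structure CommProduct (K : Type*) [Field K] (V : Type*) [AddCommGroup V] [Module K V] where
  mul : TensorAlgebra K V →ₗ[K] TensorAlgebra K V →ₗ[K] TensorAlgebra K V
  mul_comm : ∀ a b, mul a b = mul b a
  mul_assoc : ∀ a b c, mul (mul a b) c = mul a (mul b c)
  one_mul : ∀ a, mul 1 a = a
  map_counit : ∀ a b, counit K V (mul a b) = counit K V a * counit K V b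
  map_comul : ∀ a b, comul K V (mul a b) =
    TensorProduct.map₂ mul mul (comul K V a) (comul K V b)

section Product

variable {K : Type*} [Field K] {V : Type*} [AddCommGroup V] [Module K V]

/-- The space `T(V)` seen as the bialgebra `(T(V), *, Δ)`. -/
def CommProduct.Alg (_P : CommProduct K V) : Type _ := TensorAlgebra K V

namespace CommProduct

variable (P : CommProduct K V)

instance : AddCommGroup P.Alg := inferInstanceAs (AddCommGroup (TensorAlgebra K V))

instance : Module K P.Alg := inferInstanceAs (Module K (TensorAlgebra K V))

/-- The identity of `T(V)`, as a linear map to `(T(V), *)`. -/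
def toAlg : TensorAlgebra K V ≃ₗ[K] P.Alg := LinearEquiv.refl K (TensorAlgebra K V)

instance : CommRing P.Alg where
  __ := (inferInstance : AddCommGroup P.Alg)
  mul a b := P.mul a b
  one := P.toAlg 1
  mul_assoc := P.mul_assoc
  mul_comm := P.mul_comm
  one_mul := P.one_mul
  mul_one a := (P.mul_comm a _).trans (P.one_mul a)
  left_distrib a b c := map_add (P.mul a) b c
  right_distrib a b c := LinearMap.map_add₂ P.mul a b c
  zero_mul a := LinearMap.map_zero₂ P.mul a
  mul_zero a := map_zero (P.mul a)

instance : Algebra K P.Alg :=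
  Algebra.ofModule (fun r x y => LinearMap.map_smul₂ P.mul r x y)
    (fun r x y => map_smul (P.mul x) r y)

theorem toAlg_mul (a b : TensorAlgebra K V) :
    P.toAlg (P.mul a b) = P.toAlg a * P.toAlg b := rfl

theorem toAlg_one : P.toAlg 1 = 1 := rfl

instance : Coalgebra K P.Alg where
  comul := comul K V
  counit := counit K V
  coassoc := comul_coassoc K V
  rTensor_counit_comp_comul := counit_comul_left K V
  lTensor_counit_comp_comul := counit_comul_right K V

instance : Bialgebra K P.Alg := by
  have key : ∀ x y : P.Alg ⊗[K] P.Alg,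
      TensorProduct.map₂ (LinearMap.mul K P.Alg) (LinearMap.mul K P.Alg) x y = x * y := by
    intro x y
    induction x using TensorProduct.induction_on with
    | zero => simp
    | add x x' hx hx' => rw [map_add, LinearMap.add_apply, hx, hx', add_mul]
    | tmul p q =>
      induction y using TensorProduct.induction_on with
      | zero => simp
      | add y y' hy hy' => rw [map_add, hy, hy', mul_add]
      | tmul r s => simp
  exact Bialgebra.mk' K P.Alg counit_one (fun {a b} => P.map_counit a b) comul_one
    (fun {a b} => (P.map_comul a b).trans (key _ _))

/-- For a composition `c` of `n` with blocks of lengths `n₁, …, n_k`, the multilinear map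
`(v₁, …, vₙ) ↦ w₁ * ⋯ * w_k`, where `v₁ ⋯ vₙ = w₁ ⋯ w_k` and the word `wᵢ` has length `nᵢ`. The
compositions of `n` index the decompositions of a word of length `n` into non-empty words. -/
def blockProd {n : ℕ} (c : Composition n) :
    MultilinearMap K (fun _ : Fin n => V) (TensorAlgebra K V) :=
  have update : ∀ [DecidableEq (Fin n)] (v : Fin n → V) (j : Fin n) (x : V),
      (fun i => P.toAlg (TensorAlgebra.tprod K V (c.blocksFun i)
        (Function.update v j x ∘ c.embedding i))) =
      Function.update
        (fun i => P.toAlg (TensorAlgebra.tprod K V (c.blocksFun i) (v ∘ c.embedding i)))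
        (c.index j)
        (P.toAlg (TensorAlgebra.tprod K V (c.blocksFun (c.index j))
          (Function.update (v ∘ c.embedding (c.index j)) (c.invEmbedding j) x))) := by
    intro _ v j x
    ext k
    by_cases h : k = c.index j
    · subst h
      rw [Function.update_self, ← Function.update_comp_eq_of_injective _ (c.embedding _).injective,
        c.embedding_comp_inv]
    · rw [Function.update_of_ne h, Function.update_comp_eq_of_notMem_range]
      rwa [c.mem_range_embedding_iff']
  { toFun := fun v => P.toAlg.symm (∏ i : Fin c.length,
      P.toAlg (TensorAlgebra.tprod K V (c.blocksFun i) (v ∘ c.embedding i)))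
    map_update_add' := by
      intro _ v j x y
      have h := (MultilinearMap.mkPiAlgebra K (Fin c.length) P.Alg).map_update_add
        (fun i => P.toAlg (TensorAlgebra.tprod K V (c.blocksFun i) (v ∘ c.embedding i)))
        (c.index j)
      simp only [MultilinearMap.mkPiAlgebra_apply] at h
      have e := fun z => congrArg (fun f => ∏ i, f i) (update v j z)
      simp only at e
      rw [e, e, e, MultilinearMap.map_update_add, map_add, h, map_add]
    map_update_smul' := by
      intro _ v j r x
      have h := (MultilinearMap.mkPiAlgebra K (Fin c.length) P.Alg).map_update_smul
        (fun i => P.toAlg (TensorAlgebra.tprod K V (c.blocksFun i) (v ∘ c.embedding i)))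
        (c.index j)
      simp only [MultilinearMap.mkPiAlgebra_apply] at h
      have e := fun z => congrArg (fun f => ∏ i, f i) (update v j z)
      simp only at e
      rw [e, e, MultilinearMap.map_update_smul, map_smul, h, map_smul] }

/-- The restriction of the canonical idempotent to words of length `n`: `0` on the empty word, and
`v₁ ⋯ vₙ ↦ ∑_{k=1}^{n} ∑_{v₁ ⋯ vₙ = w₁ ⋯ w_k} ((-1)^{k-1} / k) w₁ * ⋯ * w_k`, with the `wᵢ` non-empty,
for `n ≥ 1`. -/
def canonicalOnWords : (n : ℕ) → MultilinearMap K (fun _ : Fin n => V) (TensorAlgebra K V)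
  | 0 => 0
  | n + 1 => ∑ c : Composition (n + 1), ((-1) ^ (c.length - 1) / (c.length : K)) • P.blockProd c

/-- The canonical idempotent `e_*`, as a linear endomorphism of `T(V)`. -/
def canonicalIdempotent : TensorAlgebra K V →ₗ[K] TensorAlgebra K V :=
  DirectSum.toModule K ℕ (TensorAlgebra K V)
      (fun n => PiTensorProduct.lift (P.canonicalOnWords n)) ∘ₗ
    TensorAlgebra.equivDirectSum.toLinearMap

theorem canonicalIdempotent_tprod {n : ℕ} (v : Fin n → V) :
    P.canonicalIdempotent (TensorAlgebra.tprod K V n v) = P.canonicalOnWords n v := by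
  simp only [canonicalIdempotent, LinearMap.comp_apply]
  erw [TensorAlgebra.toDirectSum_tensorPower_tprod]
  exact (DirectSum.toModule_lof K n _).trans (PiTensorProduct.lift.tprod v)

theorem canonicalIdempotent_one : P.canonicalIdempotent 1 = 0 := by
  simpa [TensorAlgebra.tprod_apply, canonicalOnWords] using
    P.canonicalIdempotent_tprod (n := 0) Fin.elim0

theorem canonicalIdempotent_word {n : ℕ} (hn : 0 < n) (v : Fin n → V) :
    P.canonicalIdempotent (TensorAlgebra.tprod K V n v) =
      ∑ c : Composition n, ((-1) ^ (c.length - 1) / (c.length : K)) •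
        P.toAlg.symm (∏ i : Fin c.length,
          P.toAlg (TensorAlgebra.tprod K V (c.blocksFun i) (v ∘ c.embedding i))) := by
  obtain ⟨n, rfl⟩ := Nat.exists_eq_succ_of_ne_zero hn.ne'
  rw [canonicalIdempotent_tprod]
  simp [canonicalOnWords, blockProd]

/-- The subspace `T₊(V) * T₊(V)`, spanned by the products of two elements of `T₊(V)`. -/
def augmentationSq : Submodule K (TensorAlgebra K V) :=
  Submodule.map₂ P.mul (augmentation K V) (augmentation K V)

/-- An infinitesimal endomorphism of `(T(V), *, Δ)`: a linear endomorphism that vanishes on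
`K + T₊(V) * T₊(V)`. -/
def IsInfinitesimal (φ : TensorAlgebra K V →ₗ[K] TensorAlgebra K V) : Prop :=
  Submodule.span K {1} ⊔ P.augmentationSq ≤ LinearMap.ker φ

/-- A tangent to identity infinitesimal endomorphism: its restriction to the primitive elements is
the identity. -/
def IsTangentToIdentity (φ : TensorAlgebra K V →ₗ[K] TensorAlgebra K V) : Prop :=
  P.IsInfinitesimal φ ∧
    ∀ x ∈ augmentation K V, comul K V x - x ⊗ₜ[K] 1 - 1 ⊗ₜ[K] x = 0 → φ x = x

end CommProduct

end Product

end BInfinity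

end

/-! Cutting a word into `k` non-empty pieces and multiplying them is the `k`-th convolution power of
`J = id - ηε`, so `e_*` is `log(id)` for the convolution product. The series makes sense because
deconcatenation is conilpotent: `J ^ k` kills words of length less than `k`.

The engine is polynomiality in the exponent. For fixed `x`, `k ↦ id^{*k}(x) = (1 + J)^k (x)` is a
polynomial in `k`, with constant term `ε(x)` and linear coefficient `e_*(x)`. Since `*` is
commutative, each `id^{*k}` is an algebra morphism, so these polynomials are multiplicative in `x`.
Their linear coefficients give `e_*(xy) = ε(x) e_*(y) + e_*(x) ε(y)` (`log_isCounitDerivation`),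
hence `e_*` vanishes on `I^2`, with `I = ker ε`. As `e_* - J` takes values in `I^2`, `e_*` is
idempotent; as `J ^ n` kills primitives for `n ≥ 2`, `e_*` fixes them.

For freeness, let `W` be the image and `g : A → Sym(W)` the map `e_*` followed by the inclusion. Its
exponential is an algebra morphism, and comparing linear coefficients in `exp(g) ∘ id^{*k} =
exp(kg)` gives `exp(g) ∘ e_* = g` (`IsCounitDerivation.exp_log`). So `exp(g)` is a left inverse of
`Sym(W) → A`. Surjectivity is an induction on length: modulo products of shorter words, a word
equals its image under `e_*`.

For the last claim, the coproduct forces `*` to respect the filtration by length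
(`mul_mem_filtration`), although `*` need not be graded. -/

noncomputable section

namespace BInfinity

open WithConv Coalgebra Polynomial

/-! ### Power series in a locally nilpotent element of a convolution algebra -/

section Series

variable {K : Type*} [Field K] {C : Type*} [AddCommGroup C] [Module K C] [Coalgebra K C]
  {B : Type*} [CommRing B] [Algebra K B]

/-- Local nilpotency for the convolution product. -/
def IsLocallyNilpotent (u : WithConv (C →ₗ[K] B)) : Prop :=
  ∀ x, ∃ N, ∀ n ≥ N, (u ^ n) x = 0

/-- A value of a convolution product depends on finitely many values of the factors. -/
theorem exists_finset_convMul_congr (x : C) : ∃ S : Finset C,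
    ∀ f f' g g' : WithConv (C →ₗ[K] B), (∀ y ∈ S, f y = f' y) → (∀ y ∈ S, g y = g' y) →
      (f * g) x = (f' * g') x := by
  classical
  refine ⟨(ℛ K x).index.image (ℛ K x).left ∪ (ℛ K x).index.image (ℛ K x).right, ?_⟩
  intro f f' g g' hf hg
  rw [(ℛ K x).convMul_apply, (ℛ K x).convMul_apply]
  refine Finset.sum_congr rfl fun i hi => ?_
  rw [hf _ (Finset.mem_union_left _ (Finset.mem_image_of_mem _ hi)),
    hg _ (Finset.mem_union_right _ (Finset.mem_image_of_mem _ hi))]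

namespace IsLocallyNilpotent

theorem exists_forall_mem {u : WithConv (C →ₗ[K] B)} (hu : IsLocallyNilpotent u)
    (S : Finset C) : ∃ N, ∀ x ∈ S, ∀ n ≥ N, (u ^ n) x = 0 := by
  choose N hN using hu
  exact ⟨S.sup N, fun x hx n hn => hN x n ((Finset.le_sup hx).trans hn)⟩

variable {u : WithConv (C →ₗ[K] B)} (hu : IsLocallyNilpotent u)

/-- The value at `u` of a power series, for the convolution product. -/
def series (p : PowerSeries K) : WithConv (C →ₗ[K] B) := toConv
  { toFun x := ∑ᶠ n, PowerSeries.coeff n p • (u ^ n) x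
    map_add' x y := by
      have hfin (x : C) : (Function.support fun n => PowerSeries.coeff n p • (u ^ n) x).Finite := by
        obtain ⟨N, hN⟩ := hu x
        refine (Set.finite_lt_nat N).subset fun n hn => ?_
        by_contra h
        exact hn (by simp [hN n (not_lt.mp h)])
      rw [← finsum_add_distrib (hfin x) (hfin y)]
      simp [map_add, smul_add]
    map_smul' r x := by
      simp only [RingHom.id_apply]
      rw [smul_finsum]
      refine finsum_congr fun n => ?_
      rw [map_smul, smul_comm] }

theorem series_apply (p : PowerSeries K) {x : C} {N : ℕ} (hN : ∀ n ≥ N, (u ^ n) x = 0) :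
    hu.series p x = ∑ n ∈ Finset.range N, PowerSeries.coeff n p • (u ^ n) x := by
  refine finsum_eq_sum_of_support_subset _ fun n hn => ?_
  simp only [Finset.coe_range, Set.mem_Iio]
  by_contra h
  exact hn (by simp [hN n (not_lt.mp h)])

theorem series_one : hu.series 1 = 1 := by
  refine WithConv.ofConv_injective (LinearMap.ext fun x => ?_)
  obtain ⟨N, hN⟩ := hu x
  change hu.series 1 x = _
  rw [hu.series_apply 1 (N := N + 1) (fun n hn => hN n (by lia)), Finset.sum_eq_single 0]
  · simp
  · intro n _ hn
    simp [PowerSeries.coeff_one, hn]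
  · simp

theorem aeval_apply (p : K[X]) {x : C} {N : ℕ} (hN : ∀ n ≥ N, (u ^ n) x = 0) :
    aeval u p x = ∑ n ∈ Finset.range N, p.coeff n • (u ^ n) x := by
  rw [aeval_eq_sum_range' (n := N + (p.natDegree + 1)) (by lia), ofConv_sum, LinearMap.sum_apply]
  refine (Finset.sum_subset (Finset.range_mono (by lia)) fun n _ hn => ?_).symm
  simp [hN n (by simpa using hn)]

/-- At a given `x` only finitely many values of the factors matter, so one truncation order serves
all of them, and evaluation of polynomials is multiplicative. -/
theorem series_mul (p q : PowerSeries K) : hu.series (p * q) = hu.series p * hu.series q := by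
  classical
  refine WithConv.ofConv_injective (LinearMap.ext fun x => ?_)
  change hu.series (p * q) x = (hu.series p * hu.series q) x
  obtain ⟨S, hS⟩ := exists_finset_convMul_congr (B := B) (K := K) x
  obtain ⟨N, hN⟩ := hu.exists_forall_mem (insert x S)
  have key (r : PowerSeries K) (y : C) (hy : y ∈ insert x S) :
      hu.series r y = aeval u (r.trunc N) y := by
    rw [hu.series_apply r (hN y hy), aeval_apply _ (hN y hy)]
    refine Finset.sum_congr rfl fun n hn => ?_
    rw [PowerSeries.coeff_trunc, if_pos (Finset.mem_range.mp hn)]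
  have hx := hN x (Finset.mem_insert_self _ _)
  rw [hS (hu.series p) (aeval u (p.trunc N)) (hu.series q) (aeval u (q.trunc N))
    (fun y hy => key p y (Finset.mem_insert_of_mem hy))
    (fun y hy => key q y (Finset.mem_insert_of_mem hy)), ← map_mul, aeval_apply _ hx,
    hu.series_apply (p * q) hx]
  refine Finset.sum_congr rfl fun n hn => ?_
  rw [PowerSeries.coeff_mul_eq_coeff_trunc_mul_trunc p q (Finset.mem_range.mp hn),
    ← Polynomial.coeff_coe, Polynomial.coe_mul]

theorem series_pow (p : PowerSeries K) (k : ℕ) : hu.series (p ^ k) = hu.series p ^ k := by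
  induction k with
  | zero => simp [hu.series_one]
  | succ k ih => rw [pow_succ, pow_succ, hu.series_mul, ih]

/-- The polynomial whose value at `t` is the value at `x` of the exponential of `t u`. -/
def expPoly (x : C) : B[X] :=
  ∑ n ∈ Finset.range (hu x).choose, monomial n ((n.factorial : K)⁻¹ • (u ^ n) x)

theorem coeff_expPoly (x : C) (n : ℕ) :
    (hu.expPoly x).coeff n = (n.factorial : K)⁻¹ • (u ^ n) x := by
  rw [expPoly, finsetSum_coeff]
  simp only [coeff_monomial, Finset.sum_ite_eq', Finset.mem_range]
  split_ifs with h
  · rfl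
  · simp [(hu x).choose_spec n (not_lt.mp h)]

/-- The polynomial whose value at `k` is the value at `x` of `(1 + u) ^ k`. -/
def binomialPoly (x : C) : B[X] :=
  ∑ n ∈ Finset.range (hu x).choose, (n.factorial : K)⁻¹ • (u ^ n) x • descPochhammer B n

variable [CharZero K]

theorem eval_expPoly (x : C) (k : ℕ) :
    (hu.expPoly x).eval (k : B) = (hu.series (PowerSeries.exp K) ^ k) x := by
  rw [← hu.series_pow, PowerSeries.exp_pow_eq_rescale_exp,
    hu.series_apply _ (hu x).choose_spec, expPoly, eval_finsetSum]
  refine Finset.sum_congr rfl fun n _ => ?_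
  rw [eval_monomial, PowerSeries.coeff_rescale, PowerSeries.coeff_exp, mul_smul, mul_comm]
  have h : (k : B) ^ n = algebraMap K B ((k : K) ^ n) := by simp
  rw [h, ← Algebra.smul_def]
  simp

/-- Binomial theorem, with `k choose n` written as the falling factorial of `k` over `n!`, which is
polynomial in `k`. -/
theorem eval_binomialPoly (x : C) (k : ℕ) :
    (hu.binomialPoly x).eval (k : B) = ((1 + u) ^ k) x := by
  have hN := (hu x).choose_spec
  have h : ((1 + u) ^ k) = aeval u ((1 + X : K[X]) ^ k) := by simp
  rw [h, aeval_apply _ hN, binomialPoly, eval_finsetSum]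
  refine Finset.sum_congr rfl fun n _ => ?_
  rw [eval_smul, eval_smul, descPochhammer_eval_eq_descFactorial, coeff_one_add_X_pow,
    Nat.descFactorial_eq_factorial_mul_choose, smul_eq_mul, mul_comm, Nat.cast_mul, mul_assoc,
    ← nsmul_eq_mul, ← nsmul_eq_mul, ← Nat.cast_smul_eq_nsmul K, smul_smul,
    inv_mul_cancel₀ (Nat.cast_ne_zero.mpr n.factorial_ne_zero), one_smul, Nat.cast_smul_eq_nsmul]

theorem coeff_zero_binomialPoly (x : C) :
    (hu.binomialPoly x).coeff 0 = algebraMap K B (Coalgebra.counit (R := K) x) := by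
  have h := hu.eval_binomialPoly x 0
  rw [coeff_zero_eq_eval_zero]
  simpa using h

/-- The power series `log (1 + X)`. -/
def _root_.BInfinity.logSeries (K : Type*) [Field K] : PowerSeries K :=
  PowerSeries.mk fun n => (-1) ^ (n - 1) / (n : K)

theorem _root_.BInfinity.coeff_one_descPochhammer (B : Type*) [CommRing B] (n : ℕ) :
    (descPochhammer B (n + 1)).coeff 1 = (-1) ^ n * (n.factorial : B) := by
  rw [descPochhammer_succ_left, coeff_X_mul, coeff_zero_eq_eval_zero, eval_comp]
  induction n with
  | zero => simp
  | succ n ih =>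
    rw [descPochhammer_succ_right, eval_mul, ih, Nat.factorial_succ]
    simp
    ring

/-- The logarithm is the derivative at `k = 0` of `(1 + u)^k`. -/
theorem coeff_one_binomialPoly (x : C) :
    (hu.binomialPoly x).coeff 1 = hu.series (logSeries K) x := by
  rw [hu.series_apply _ (hu x).choose_spec, binomialPoly, finsetSum_coeff]
  refine Finset.sum_congr rfl fun n _ => ?_
  rw [coeff_smul, coeff_smul, logSeries, PowerSeries.coeff_mk]
  cases n with
  -- The constant coefficient of `logSeries` is a division by zero, hence `0`, as it should be.
  | zero => simp [coeff_one]
  | succ n =>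
    have h : ((-1) ^ n * (n.factorial : B)) = algebraMap K B ((-1) ^ n * (n.factorial : K)) := by
      simp
    rw [coeff_one_descPochhammer, h, smul_eq_mul, mul_comm, ← Algebra.smul_def, smul_smul,
      Nat.factorial_succ]
    congr 1
    have h1 : (n.factorial : K) ≠ 0 := Nat.cast_ne_zero.mpr n.factorial_ne_zero
    have h2 : ((n : K) + 1) ≠ 0 := Nat.cast_add_one_ne_zero n
    push_cast
    field_simp

end IsLocallyNilpotent

/-- A polynomial with coefficients in an algebra over a field of characteristic zero is determined
by its values at the natural numbers. -/
theorem polynomial_eq_of_eval_natCast [CharZero K] {p q : B[X]}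
    (h : ∀ k : ℕ, p.eval (k : B) = q.eval (k : B)) : p = q := by
  rw [← sub_eq_zero]
  set r := p - q with hr
  have h0 (k : ℕ) : r.eval (k : B) = 0 := by simp [hr, h]
  ext i
  rw [coeff_zero]
  -- `B` need not be a domain: linear forms on `B` move the root count to `K[X]`.
  refine (Module.forall_dual_apply_eq_zero_iff K _).mp fun l => ?_
  set s : K[X] := ∑ n ∈ Finset.range (r.natDegree + 1), monomial n (l (r.coeff n)) with hs
  have hs0 : s = 0 := by
    refine Polynomial.eq_zero_of_infinite_isRoot s (Set.Infinite.mono ?_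
      (Set.infinite_range_of_injective (Nat.cast_injective (R := K))))
    rintro _ ⟨k, rfl⟩
    have h1 := congrArg l (h0 k)
    rw [eval_eq_sum_range, map_sum, map_zero] at h1
    rw [Set.mem_ofPred_eq, IsRoot.def, hs, eval_finsetSum, ← h1]
    refine Finset.sum_congr rfl fun n _ => ?_
    rw [eval_monomial, ← Nat.cast_pow, ← Nat.cast_pow, mul_comm, mul_comm (r.coeff n),
      ← nsmul_eq_mul, ← nsmul_eq_mul, map_nsmul]
  have h2 := congrArg (fun t => coeff t i) hs0
  simp only [hs, finsetSum_coeff, coeff_monomial, Finset.sum_ite_eq', Finset.mem_range,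
    coeff_zero] at h2
  split_ifs at h2 with h3
  · exact h2
  · rw [coeff_eq_zero_of_natDegree_lt (by lia), map_zero]

end Series

/-! ### Functoriality of convolution powers -/

section ConvPow

variable {K : Type*} [Field K] {C D : Type*} [AddCommGroup C] [Module K C] [Coalgebra K C]
  [AddCommGroup D] [Module K D] [Coalgebra K D]
  {B B' : Type*} [CommRing B] [Algebra K B] [CommRing B'] [Algebra K B']

theorem convPow_comp_coalgHom (f : WithConv (C →ₗ[K] B)) (h : D →ₗc[K] C) (n : ℕ) :
    toConv ((f ^ n).ofConv ∘ₗ h.toLinearMap) = toConv (f.ofConv ∘ₗ h.toLinearMap) ^ n := by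
  induction n with
  | zero =>
    rw [pow_zero, pow_zero, LinearMap.convOne_def, LinearMap.convOne_def, ofConv_toConv,
      LinearMap.comp_assoc, h.counit_comp]
  | succ n ih =>
    rw [pow_succ, LinearMap.convMul_comp_coalgHom_distrib, ih, toConv_ofConv, ← pow_succ]

theorem algHom_comp_convPow (h : B →ₐ[K] B') (f : WithConv (C →ₗ[K] B)) (n : ℕ) :
    toConv (h.toLinearMap ∘ₗ (f ^ n).ofConv) = toConv (h.toLinearMap ∘ₗ f.ofConv) ^ n := by
  induction n with
  | zero =>
    rw [pow_zero, pow_zero]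
    ext x
    simp
  | succ n ih =>
    rw [pow_succ, LinearMap.algHom_comp_convMul_distrib, ih, toConv_ofConv, ← pow_succ]

theorem toConv_map_pow (f : WithConv (C →ₗ[K] B)) (g : WithConv (D →ₗ[K] B')) (n : ℕ) :
    toConv (TensorProduct.map f.ofConv g.ofConv) ^ n =
      toConv (TensorProduct.map (f ^ n).ofConv (g ^ n).ofConv) := by
  induction n with
  | zero =>
    ext x y
    simp [Algebra.algebraMap_eq_smul_one, TensorProduct.tmul_smul, TensorProduct.smul_tmul',
      Algebra.TensorProduct.one_def, mul_comm, smul_smul]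
  | succ n ih => rw [pow_succ, ih, TensorProduct.map_convMul_map, pow_succ, pow_succ]

end ConvPow

/-! ### Logarithm of the identity of a commutative bialgebra -/

section Bialgebra

variable {K : Type*} [Field K] {A : Type*} [CommRing A] [Bialgebra K A]
  {B : Type*} [CommRing B] [Algebra K B]

/-- A derivation at the counit. -/
def IsCounitDerivation (g : A →ₗ[K] B) : Prop :=
  ∀ x y, g (x * y) = algebraMap K B (Coalgebra.counit (R := K) x) * g y +
    g x * algebraMap K B (Coalgebra.counit (R := K) y)

/-- Composed with the multiplication of `A`, which is a coalgebra morphism, `g` becomes `g ⊗ 1 + 1 ⊗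
g` followed by the multiplication of `B`. The two summands commute for convolution, so the binomial
theorem applies. -/
theorem IsCounitDerivation.convPow_mul {g : A →ₗ[K] B} (hg : IsCounitDerivation g) (n : ℕ)
    (x y : A) : (toConv g ^ n) (x * y) = ∑ i ∈ Finset.range (n + 1),
      n.choose i • ((toConv g ^ i) x * (toConv g ^ (n - i)) y) := by
  set a : WithConv (A ⊗[K] A →ₗ[K] B ⊗[K] B) :=
    toConv (TensorProduct.map (toConv g).ofConv (1 : WithConv (A →ₗ[K] B)).ofConv) with ha
  set b : WithConv (A ⊗[K] A →ₗ[K] B ⊗[K] B) :=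
    toConv (TensorProduct.map (1 : WithConv (A →ₗ[K] B)).ofConv (toConv g).ofConv) with hb
  have hab : Commute a b := by
    change a * b = b * a
    rw [ha, hb, TensorProduct.map_convMul_map, TensorProduct.map_convMul_map, one_mul, mul_one]
  have h1 : toConv ((toConv g).ofConv ∘ₗ (Bialgebra.mulCoalgHom K A).toLinearMap) =
      toConv ((Algebra.TensorProduct.lmul' K (S := B)).toLinearMap ∘ₗ (a + b).ofConv) := by
    ext x y
    simp [ha, hb, hg x y, add_comm]
  have h2 := convPow_comp_coalgHom (toConv g) (Bialgebra.mulCoalgHom K A) n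
  rw [h1, ← algHom_comp_convPow, hab.add_pow] at h2
  have h3 := congrArg (fun f : WithConv (A ⊗[K] A →ₗ[K] B) => f (x ⊗ₜ[K] y)) h2
  have h4 : (toConv g ^ n) (x * y) = _ := h3
  rw [h4]
  simp only [LinearMap.comp_apply, ofConv_sum, LinearMap.sum_apply, map_sum]
  refine Finset.sum_congr rfl fun i _ => ?_
  rw [ha, hb, toConv_map_pow, toConv_map_pow, TensorProduct.map_convMul_map, one_pow, one_pow,
    one_mul, mul_one, ← Nat.cast_comm, ← nsmul_eq_mul, ← Nat.cast_smul_eq_nsmul K, ofConv_smul,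
    LinearMap.smul_apply, map_smul, Nat.cast_smul_eq_nsmul]
  simp

variable (K A) in
/-- The identity minus the unit of the convolution product. -/
def reducedId : WithConv (A →ₗ[K] A) := toConv LinearMap.id - 1

theorem reducedId_apply (x : A) :
    reducedId K A x = x - algebraMap K A (Coalgebra.counit (R := K) x) := rfl

/-- Commutativity of `A` enters here: convolution powers of the identity are algebra morphisms. -/
theorem one_add_reducedId_pow (k : ℕ) :
    (1 + reducedId K A) ^ k =
      toConv ((toConv (AlgHom.id K A)) ^ k : WithConv (A →ₐ[K] A)).ofConv.toLinearMap := by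
  rw [AlgHom.toLinearMap_convPow, reducedId, add_sub_cancel]
  rfl

theorem reducedId_pow_mem (n : ℕ) (x : A) :
    (reducedId K A ^ n) x ∈ RingHom.ker (Bialgebra.counitAlgHom K A) ^ n := by
  induction n generalizing x with
  | zero => simp
  | succ n ih =>
    rw [pow_succ, pow_succ, (ℛ K x).convMul_apply]
    refine Ideal.sum_mem _ fun i _ => Ideal.mul_mem_mul (ih _) ?_
    rw [RingHom.mem_ker, reducedId_apply, map_sub]
    simp

theorem reducedId_pow_apply_of_primitive {x : A}
    (hx : Coalgebra.comul (R := K) x = x ⊗ₜ[K] 1 + 1 ⊗ₜ[K] x) {n : ℕ} (hn : 2 ≤ n) :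
    (reducedId K A ^ n) x = 0 := by
  have h1 : (reducedId K A) 1 = 0 := by rw [reducedId_apply]; simp
  obtain ⟨n, rfl⟩ := Nat.exists_eq_add_of_le' hn
  have h2 : (reducedId K A ^ (n + 1)) 1 = 0 := by
    rw [pow_succ]
    simp [h1, Algebra.TensorProduct.one_def]
  rw [show n + 2 = n + 1 + 1 from rfl, pow_succ]
  simp [hx, h1, h2]

/-- The remaining terms involve `J ^ n` with `n ≥ 2`, whose values are sums of products of `n`
elements of the augmentation ideal. -/
theorem log_sub_reducedId_mem (hJ : IsLocallyNilpotent (reducedId K A)) (x : A) :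
    hJ.series (logSeries K) x - reducedId K A x ∈
      RingHom.ker (Bialgebra.counitAlgHom K A) ^ 2 := by
  obtain ⟨N, hN⟩ := hJ x
  rw [hJ.series_apply (N := N + 2) _ (fun n hn => hN n (by lia)), Finset.sum_range_succ',
    Finset.sum_range_succ']
  simp only [logSeries, PowerSeries.coeff_mk]
  simp only [zero_add, tsub_self, pow_zero, pow_one, Nat.cast_one, div_one, one_smul,
    Nat.cast_zero, div_zero, zero_smul, add_zero, add_sub_cancel_right]
  refine Ideal.sum_mem _ fun n _ => ?_
  rw [Algebra.smul_def]
  exact Ideal.mul_mem_left _ _ (Ideal.pow_le_pow_right (by lia) (reducedId_pow_mem _ x))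

variable [CharZero K]

/-- This is the Leibniz formula `convPow_mul` divided by `n!`. -/
theorem IsCounitDerivation.expPoly_mul {g : A →ₗ[K] B} (hg : IsCounitDerivation g)
    (hu : IsLocallyNilpotent (toConv g)) (x y : A) :
    hu.expPoly (x * y) = hu.expPoly x * hu.expPoly y := by
  ext n
  rw [coeff_mul, Finset.Nat.sum_antidiagonal_eq_sum_range_succ
    fun i j => (hu.expPoly x).coeff i * (hu.expPoly y).coeff j]
  simp only [hu.coeff_expPoly]
  rw [hg.convPow_mul, Finset.smul_sum]
  refine Finset.sum_congr rfl fun i hi => ?_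
  rw [smul_mul_smul_comm, ← Nat.cast_smul_eq_nsmul K, smul_smul,
    Nat.cast_choose K (Finset.mem_range_succ_iff.mp hi)]
  congr 1
  have h (m : ℕ) : (m.factorial : K) ≠ 0 := Nat.cast_ne_zero.mpr m.factorial_ne_zero
  have h1 := h n
  have h2 := h i
  have h3 := h (n - i)
  field_simp

/-- The exponential of a derivation at the counit, as an algebra morphism. -/
def IsCounitDerivation.exp {g : A →ₗ[K] B} (hg : IsCounitDerivation g)
    (hu : IsLocallyNilpotent (toConv g)) (h1 : g 1 = 0) : A →ₐ[K] B :=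
  AlgHom.ofLinearMap (hu.series (PowerSeries.exp K)).ofConv
    (by
      have hN : ∀ n ≥ 1, (toConv g ^ n) (1 : A) = 0 := by
        intro n hn
        obtain ⟨n, rfl⟩ := Nat.exists_eq_add_of_le' hn
        rw [pow_succ]
        simp [h1, Algebra.TensorProduct.one_def]
      rw [hu.series_apply _ hN]
      simp)
    (by
      intro x y
      have h (z : A) : (hu.series (PowerSeries.exp K)) z = (hu.expPoly z).eval 1 := by
        have := hu.eval_expPoly z 1
        rw [pow_one] at this
        rw [← this, Nat.cast_one]
      rw [h, h, h, hg.expPoly_mul, eval_mul])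

/-- The logarithm of the identity is a derivation at the counit. -/
theorem log_isCounitDerivation (hJ : IsLocallyNilpotent (reducedId K A)) :
    IsCounitDerivation (hJ.series (logSeries K)).ofConv := by
  intro x y
  have h : hJ.binomialPoly (x * y) = hJ.binomialPoly x * hJ.binomialPoly y := by
    refine polynomial_eq_of_eval_natCast (K := K) fun k => ?_
    rw [eval_mul, hJ.eval_binomialPoly, hJ.eval_binomialPoly, hJ.eval_binomialPoly,
      one_add_reducedId_pow]
    exact map_mul ((toConv (AlgHom.id K A)) ^ k : WithConv (A →ₐ[K] A)).ofConv x y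
  -- The linear coefficient of a product, with constant terms given by the counit, is the derivation
  -- rule.
  have h1 := congrArg (fun p => coeff p 1) h
  simpa only [mul_coeff_one, hJ.coeff_zero_binomialPoly, hJ.coeff_one_binomialPoly] using h1

theorem log_one (hJ : IsLocallyNilpotent (reducedId K A)) : hJ.series (logSeries K) 1 = 0 := by
  have h := log_isCounitDerivation hJ 1 1
  simpa using h

theorem log_eq_zero_of_mem_sq (hJ : IsLocallyNilpotent (reducedId K A)) {x : A}
    (hx : x ∈ RingHom.ker (Bialgebra.counitAlgHom K A) ^ 2) : hJ.series (logSeries K) x = 0 := by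
  rw [pow_two] at hx
  refine Submodule.mul_induction_on hx (fun y hy z hz => ?_) (fun y z hy hz => ?_)
  · rw [RingHom.mem_ker, Bialgebra.counitAlgHom_apply] at hy hz
    rw [log_isCounitDerivation hJ, hy, hz]
    simp
  · rw [map_add, hy, hz, add_zero]

/-- The logarithm of the identity is a projector. -/
theorem log_log (hJ : IsLocallyNilpotent (reducedId K A)) (x : A) :
    hJ.series (logSeries K) (hJ.series (logSeries K) x) = hJ.series (logSeries K) x := by
  have h := log_eq_zero_of_mem_sq hJ (log_sub_reducedId_mem hJ x)
  rw [map_sub, sub_eq_zero] at h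
  rw [h, reducedId_apply, map_sub, Algebra.algebraMap_eq_smul_one, map_smul, log_one, smul_zero,
    sub_zero]

/-- The logarithm of the identity fixes the primitive elements. -/
theorem log_eq_self_of_primitive (hJ : IsLocallyNilpotent (reducedId K A)) {x : A}
    (h0 : Coalgebra.counit (R := K) x = 0)
    (hx : Coalgebra.comul (R := K) x = x ⊗ₜ[K] 1 + 1 ⊗ₜ[K] x) :
    hJ.series (logSeries K) x = x := by
  rw [hJ.series_apply (N := 2) _ (fun n hn => reducedId_pow_apply_of_primitive hx hn)]
  simp [Finset.sum_range_succ, logSeries, reducedId_apply, h0]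

/-- The exponential of a derivation at the counit `g` maps the logarithm of the identity to `g`. -/
theorem IsCounitDerivation.exp_log {g : A →ₗ[K] B} (hg : IsCounitDerivation g)
    (hu : IsLocallyNilpotent (toConv g)) (h1 : g 1 = 0)
    (hJ : IsLocallyNilpotent (reducedId K A)) (x : A) :
    hg.exp hu h1 (hJ.series (logSeries K) x) = g x := by
  -- At `t = k` this reads `exp(g) ∘ id^{*k} = exp(g)^{*k}`; the linear coefficients in `t` are then
  -- compared.
  have h : (hJ.binomialPoly x).map (hg.exp hu h1).toRingHom = hu.expPoly x := by
    refine polynomial_eq_of_eval_natCast (K := K) fun k => ?_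
    have e : (k : B) = (hg.exp hu h1).toRingHom (k : A) := by simp
    rw [hu.eval_expPoly, e, eval_map_apply, hJ.eval_binomialPoly, one_add_reducedId_pow,
      AlgHom.toLinearMap_convPow]
    exact congrArg (fun f : WithConv (A →ₗ[K] B) => f x)
      (algHom_comp_convPow (hg.exp hu h1) (toConv (AlgHom.id K A).toLinearMap) k)
  have h2 := congrArg (fun p => coeff p 1) h
  simp only [coeff_map, hJ.coeff_one_binomialPoly, hu.coeff_expPoly] at h2
  simpa using h2

/-- The range of the logarithm of the identity freely generates `A` if it generates `A`. -/
theorem isSymmetricAlgebra_of_range_log (hJ : IsLocallyNilpotent (reducedId K A))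
    (W : Submodule K A) (hW : ∀ x, hJ.series (logSeries K) x ∈ W)
    (hWid : ∀ x ∈ W, hJ.series (logSeries K) x = x)
    (hnil : ∀ g : A →ₗ[K] SymmetricAlgebra K W, g 1 = 0 → IsLocallyNilpotent (toConv g))
    (hgen : Algebra.adjoin K (W : Set A) = ⊤) : IsSymmetricAlgebra W.subtype := by
  set g : A →ₗ[K] SymmetricAlgebra K W :=
    SymmetricAlgebra.ι K W ∘ₗ (hJ.series (logSeries K)).ofConv.codRestrict W hW with hgdef
  have hlog := log_isCounitDerivation hJ
  have hg : IsCounitDerivation g := by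
    intro x y
    have : (hJ.series (logSeries K)).ofConv.codRestrict W hW (x * y) =
        (Coalgebra.counit (R := K) x) • (hJ.series (logSeries K)).ofConv.codRestrict W hW y +
        (Coalgebra.counit (R := K) y) • (hJ.series (logSeries K)).ofConv.codRestrict W hW x := by
      ext
      simpa [Algebra.smul_def, mul_comm] using hlog x y
    rw [hgdef, LinearMap.comp_apply, this, map_add, map_smul, map_smul, Algebra.smul_def,
      Algebra.smul_def, mul_comm (algebraMap _ _ (Coalgebra.counit y))]
    rfl
  have h1 : g 1 = 0 := by
    have h := hg 1 1
    simpa using h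
  refine ⟨?_, ?_⟩
  -- Injectivity: on a generator `w = log(w)`, `exp(g)` returns `g w`, the class of `w` in the
  -- symmetric algebra.
  · have hleft : (hg.exp (hnil g h1) h1).comp (SymmetricAlgebra.lift W.subtype) =
        AlgHom.id K (SymmetricAlgebra K W) := by
      refine SymmetricAlgebra.algHom_ext (LinearMap.ext fun w => ?_)
      change hg.exp (hnil g h1) h1 (SymmetricAlgebra.lift W.subtype (SymmetricAlgebra.ι K W w)) =
        SymmetricAlgebra.ι K W w
      rw [SymmetricAlgebra.lift_ι_apply, W.subtype_apply, ← hWid w w.2, hg.exp_log]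
      rw [hgdef, LinearMap.comp_apply]
      congr 1
      ext
      exact hWid w w.2
    exact Function.LeftInverse.injective (g := hg.exp (hnil g h1) h1)
      (fun x => congrArg (fun f : SymmetricAlgebra K W →ₐ[K] SymmetricAlgebra K W => f x) hleft)
  · rw [← AlgHom.range_eq_top, eq_top_iff, ← hgen, Algebra.adjoin_le_iff]
    intro w hw
    exact ⟨SymmetricAlgebra.ι K W ⟨w, hw⟩, SymmetricAlgebra.lift_ι_apply _ _⟩

end Bialgebra

/-! ### Compositions as lists of positive integers -/

section Compositions

/-- The lists of `k` positive integers of sum `n`. -/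
def posLists : ℕ → ℕ → Finset (List ℕ)
  | 0, n => if n = 0 then {[]} else ∅
  | k + 1, n => (Finset.range n).biUnion fun i =>
      (posLists k (n - (i + 1))).image (List.cons (i + 1))

theorem mem_posLists {k n : ℕ} {l : List ℕ} :
    l ∈ posLists k n ↔ l.length = k ∧ l.sum = n ∧ ∀ b ∈ l, 0 < b := by
  induction k generalizing n l with
  | zero =>
    rw [posLists, List.length_eq_zero_iff]
    split_ifs with h
    · subst h
      simp +contextual
    · simp only [Finset.notMem_empty, false_iff]
      rintro ⟨rfl, h', -⟩
      exact h h'.symm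
  | succ k ih =>
    simp only [posLists, Finset.mem_biUnion, Finset.mem_range, Finset.mem_image, ih]
    constructor
    · rintro ⟨i, hi, l, ⟨h1, h2, h3⟩, rfl⟩
      simp only [List.length_cons, h1, List.sum_cons, h2, List.mem_cons, forall_eq_or_imp]
      exact ⟨trivial, by lia, by lia, h3⟩
    · rintro ⟨h1, h2, h3⟩
      cases l with
      | nil => simp at h1
      | cons b l =>
        simp only [List.length_cons, List.sum_cons, List.mem_cons, forall_eq_or_imp] at h1 h2 h3
        exact ⟨b - 1, by lia, l, ⟨by lia, by lia, h3.2⟩, by congr 1; lia⟩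

/-- Splitting off the first block mirrors the recursion `J ^ (k + 1) = J * J ^ k`. -/
theorem sum_posLists_succ {M : Type*} [AddCommMonoid M] (F : List ℕ → M) (k n : ℕ) :
    ∑ l ∈ posLists (k + 1) n, F l =
      ∑ i ∈ Finset.range n, ∑ l ∈ posLists k (n - (i + 1)), F ((i + 1) :: l) := by
  rw [posLists, Finset.sum_biUnion]
  · refine Finset.sum_congr rfl fun i _ => ?_
    exact Finset.sum_image fun x _ y _ h => (List.cons_injective h)
  · intro i _ j _ hij
    rw [Function.onFun, Finset.disjoint_left]
    intro l hl hl'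
    obtain ⟨x, _, rfl⟩ := Finset.mem_image.mp hl
    obtain ⟨y, _, h⟩ := Finset.mem_image.mp hl'
    exact hij (by simpa using (List.cons_eq_cons.mp h).1.symm)

theorem sum_composition {M : Type*} [AddCommMonoid M] {n : ℕ} (F : ℕ → List ℕ → M) :
    ∑ c : Composition n, F c.length c.blocks =
      ∑ k ∈ Finset.range (n + 1), ∑ l ∈ posLists k n, F k l := by
  classical
  rw [← Finset.sum_fiberwise_of_maps_to (t := Finset.range (n + 1)) (g := Composition.length)
    (fun c _ => Finset.mem_range_succ_iff.mpr c.length_le)]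
  refine Finset.sum_congr rfl fun k _ => ?_
  refine Finset.sum_bij (fun c _ => c.blocks) (fun c hc => ?_) (fun c _ c' _ h => Composition.ext h)
    (fun l hl => ?_) (fun c hc => ?_)
  · exact mem_posLists.mpr ⟨(Finset.mem_filter.mp hc).2, c.blocks_sum, fun b hb => c.blocks_pos hb⟩
  · obtain ⟨h1, h2, h3⟩ := mem_posLists.mp hl
    exact ⟨⟨l, fun hb => h3 _ hb, h2⟩, by simpa [Composition.length] using h1, rfl⟩
  · rw [(Finset.mem_filter.mp hc).2]

end Compositions

/-! ### Convolution on words, and `e_*` as a logarithm -/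

section Words

variable {K : Type*} [Field K] {V : Type*} [AddCommGroup V] [Module K V]

theorem word_append (l m : List V) : word K (l ++ m) = word K l * word K m := by simp [word]

theorem span_word : Submodule.span K (Set.range (word K : List V → TensorAlgebra K V)) = ⊤ := by
  rw [eq_top_iff]
  rintro x -
  induction x using TensorAlgebra.induction with
  | algebraMap r =>
    rw [Algebra.algebraMap_eq_smul_one, ← word_nil]
    exact Submodule.smul_mem _ _ (Submodule.subset_span ⟨[], rfl⟩)
  | ι v => exact Submodule.subset_span ⟨[v], by simp [word]⟩
  | add a b ha hb => exact Submodule.add_mem _ ha hb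
  | mul a b ha hb =>
    refine (?_ : _ ≤ Submodule.span K _) (Submodule.mul_mem_mul ha hb)
    rw [Submodule.span_mul_span, Submodule.span_le]
    rintro _ ⟨_, ⟨l, rfl⟩, _, ⟨m, rfl⟩, rfl⟩
    exact Submodule.subset_span ⟨l ++ m, word_append l m⟩

theorem counit_word (l : List V) : counit K V (word K l) = if l = [] then 1 else 0 := by
  cases l with
  | nil => simp [word_nil, counit_one]
  | cons v l => simp [word_cons, counit_ι_mul]

namespace CommProduct

variable (P : CommProduct K V)

/-- A word, as an element of `(T(V), *)`. -/
def algWord (l : List V) : P.Alg := P.toAlg (word K l)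

theorem span_algWord : Submodule.span K (Set.range P.algWord) = ⊤ := span_word

theorem algWord_nil : P.algWord [] = 1 := word_nil

theorem comul_algWord (l : List V) : Coalgebra.comul (R := K) (P.algWord l) =
    ∑ i ∈ Finset.range (l.length + 1), P.algWord (l.take i) ⊗ₜ[K] P.algWord (l.drop i) :=
  comul_word l

theorem counit_algWord (l : List V) :
    Coalgebra.counit (R := K) (P.algWord l) = if l = [] then 1 else 0 :=
  counit_word l

section Conv

variable {B : Type*} [CommRing B] [Algebra K B]

theorem convMul_algWord (f g : WithConv (P.Alg →ₗ[K] B)) (l : List V) :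
    (f * g) (P.algWord l) = ∑ i ∈ Finset.range (l.length + 1),
      f (P.algWord (l.take i)) * g (P.algWord (l.drop i)) := by
  rw [LinearMap.convMul_apply, comul_algWord]
  simp

/-- When a word is cut into more pieces than it has letters, some piece is empty, and `g` kills it.
-/
theorem convPow_algWord_eq_zero {g : WithConv (P.Alg →ₗ[K] B)} (hg : g 1 = 0) {n : ℕ}
    {l : List V} (h : l.length < n) : (g ^ n) (P.algWord l) = 0 := by
  induction n generalizing l with
  | zero => simp at h
  | succ n ih =>
    rw [pow_succ', convMul_algWord]
    refine Finset.sum_eq_zero fun i _ => ?_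
    cases i with
    | zero => simp [algWord_nil, hg]
    | succ i =>
      rcases l with _ | ⟨v, l⟩
      · simp [algWord_nil, hg]
      · rw [ih (by simp at h ⊢; lia), mul_zero]

/-- `(T(V), Δ)` is conilpotent. -/
theorem isLocallyNilpotent {g : P.Alg →ₗ[K] B} (hg : g 1 = 0) :
    IsLocallyNilpotent (toConv g) := by
  intro x
  have hx : x ∈ Submodule.span K (Set.range P.algWord) := by rw [span_algWord]; trivial
  induction hx using Submodule.span_induction with
  | mem x h =>
    obtain ⟨l, rfl⟩ := h
    exact ⟨l.length + 1, fun n hn => P.convPow_algWord_eq_zero hg hn⟩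
  | zero => exact ⟨0, fun n _ => map_zero _⟩
  | add x y _ _ hx hy =>
    obtain ⟨N, hN⟩ := hx
    obtain ⟨M, hM⟩ := hy
    exact ⟨max N M, fun n hn => by
      rw [map_add, hN n (by lia), hM n (by lia), add_zero]⟩
  | smul r x _ hx =>
    obtain ⟨N, hN⟩ := hx
    exact ⟨N, fun n hn => by rw [map_smul, hN n hn, smul_zero]⟩

end Conv

theorem reducedId_one : reducedId K P.Alg 1 = 0 := by
  rw [reducedId_apply]
  simp

theorem isLocallyNilpotent_reducedId : IsLocallyNilpotent (reducedId K P.Alg) :=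
  P.isLocallyNilpotent (g := (reducedId K P.Alg).ofConv) P.reducedId_one

theorem reducedId_algWord {l : List V} (hl : l ≠ []) :
    reducedId K P.Alg (P.algWord l) = P.algWord l := by
  rw [reducedId_apply, counit_algWord, if_neg hl]
  simp

/-- Iterated deconcatenation cuts the word in all ways; `J` kills the empty pieces and fixes the
others. -/
theorem reducedId_pow_algWord (k : ℕ) (l : List V) :
    (reducedId K P.Alg ^ k) (P.algWord l) = ∑ b ∈ posLists k l.length,
      ((l.splitWrtCompositionAux b).map P.algWord).prod := by
  induction k generalizing l with
  | zero =>
    rw [pow_zero, LinearMap.convOne_apply, counit_algWord, posLists]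
    simp only [List.length_eq_zero_iff]
    split_ifs <;> simp [List.splitWrtCompositionAux]
  | succ k ih =>
    rw [pow_succ', convMul_algWord, Finset.sum_range_succ', sum_posLists_succ]
    simp only [List.take_zero, algWord_nil, reducedId_one, zero_mul, add_zero]
    refine Finset.sum_congr rfl fun i hi => ?_
    have hi' := Finset.mem_range.mp hi
    rw [reducedId_algWord _ (by simp; rintro rfl; simp at hi'), ih, Finset.mul_sum,
      List.length_drop]
    refine Finset.sum_congr rfl fun b _ => ?_
    rw [List.splitWrtCompositionAux_cons, List.map_cons, List.prod_cons]

theorem prod_composition {n : ℕ} (v : Fin n → V) (c : Composition n) :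
    ∏ i : Fin c.length, P.toAlg (TensorAlgebra.tprod K V (c.blocksFun i) (v ∘ c.embedding i)) =
      (((List.ofFn v).splitWrtCompositionAux c.blocks).map P.algWord).prod := by
  rw [← List.prod_ofFn]
  congr 1
  refine List.ext_getElem (by simp [List.length_splitWrtCompositionAux]) fun i h1 h2 => ?_
  rw [List.getElem_ofFn, List.getElem_map]
  rw [← word_ofFn]
  change P.algWord _ = _
  congr 1
  have h3 : i < ((List.ofFn v).splitWrtComposition c).length := by
    simpa [List.splitWrtComposition] using h2
  have h4 := List.getElem_splitWrtComposition' (List.ofFn v) c h3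
  refine Eq.trans ?_ h4.symm
  have hi : i < c.length := by simpa using h1
  refine List.ext_getElem ?_ fun j h5 h6 => ?_
  · have h7 := c.sizeUpTo_succ hi
    have h8 := c.sizeUpTo_le (i + 1)
    simp only [List.length_ofFn, List.length_drop, List.length_take]
    rw [min_eq_left h8, h7]
    simp [Composition.blocksFun]
  · simp only [List.getElem_ofFn, List.getElem_drop, List.getElem_take, Function.comp_apply]
    congr 1

theorem canonicalIdempotent_eq_series : P.canonicalIdempotent =
    P.toAlg.symm.toLinearMap ∘ₗ (P.isLocallyNilpotent_reducedId.series (logSeries K)).ofConv ∘ₗ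
      P.toAlg.toLinearMap := by
  refine LinearMap.ext_on span_word ?_
  rintro _ ⟨l, rfl⟩
  obtain ⟨n, v, rfl⟩ : ∃ (n : ℕ) (v : Fin n → V), l = List.ofFn v :=
    ⟨l.length, l.get, (List.ofFn_get l).symm⟩
  have h : P.canonicalIdempotent (word K (List.ofFn v)) =
      ∑ c : Composition n, ((-1) ^ (c.length - 1) / (c.length : K)) •
        P.toAlg.symm (((List.ofFn v).splitWrtCompositionAux c.blocks).map P.algWord).prod := by
    rw [word_ofFn]
    rcases n with _ | n
    · rw [canonicalIdempotent_tprod]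
      symm
      -- For the empty word the only composition has length `0`, and its coefficient, a division by
      -- zero, is `0`.
      refine Finset.sum_eq_zero fun c _ => ?_
      have : c.length = 0 := c.length_eq_zero.mpr rfl
      simp [this]
    · rw [canonicalIdempotent_word _ n.succ_pos]
      simp only [prod_composition]
  rw [h, sum_composition fun k b => ((-1) ^ (k - 1) / (k : K)) •
    P.toAlg.symm (((List.ofFn v).splitWrtCompositionAux b).map P.algWord).prod]
  change _ = P.toAlg.symm ((P.isLocallyNilpotent_reducedId.series (logSeries K))
    (P.algWord (List.ofFn v)))
  rw [P.isLocallyNilpotent_reducedId.series_apply (N := n + 1) _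
    (fun m hm => P.convPow_algWord_eq_zero P.reducedId_one (by simpa using hm)), map_sum]
  refine Finset.sum_congr rfl fun k _ => ?_
  rw [reducedId_pow_algWord, map_smul, map_sum, Finset.smul_sum, List.length_ofFn, logSeries,
    PowerSeries.coeff_mk]

end CommProduct

end Words

/-! ### Recovering an element from its coproduct -/

section LetterProjection

variable (K : Type*) [Field K] (V : Type*) [AddCommGroup V] [Module K V]

/-- The linear map `a ⊗ b ↦ a₁ b`, where `a₁` is the component of `a` of degree one and the product
is the concatenation. -/
def concatLetter : TensorAlgebra K V ⊗[K] TensorAlgebra K V →ₗ[K] TensorAlgebra K V :=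
  TensorProduct.lift
    (LinearMap.mul K (TensorAlgebra K V) ∘ₗ TensorAlgebra.ι K ∘ₗ TensorAlgebra.ιInv)

variable {K V}

theorem ιInv_word_cons (v : V) (l : List V) : TensorAlgebra.ιInv (word K (v :: l)) =
    if l = [] then v else 0 := by
  rcases l with _ | ⟨w, l⟩
  · rw [if_pos rfl, word_cons, word_nil, mul_one]
    exact TensorAlgebra.ι_leftInverse v
  · rw [if_neg (by simp), word_cons, word_cons, ← mul_assoc]
    simp [TensorAlgebra.ιInv, TrivSqZeroExt.inr_mul_inr]

theorem ιInv_one : TensorAlgebra.ιInv (1 : TensorAlgebra K V) = 0 := by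
  let : Module Kᵐᵒᵖ V := Module.compHom _ ((RingHom.id K).fromOpposite mul_comm)
  have : IsCentralScalar K V := ⟨fun r m => rfl⟩
  have h := map_one (TensorAlgebra.toTrivSqZeroExt (R := K) (M := V))
  exact (congrArg TrivSqZeroExt.snd h).trans TrivSqZeroExt.snd_one

theorem concatLetter_tmul (a b : TensorAlgebra K V) :
    concatLetter K V (a ⊗ₜ[K] b) = TensorAlgebra.ι K (TensorAlgebra.ιInv a) * b := rfl

/-- For a non-empty word only the term cut after the first letter survives, and concatenation
restores the word. -/
theorem concatLetter_comul (x : TensorAlgebra K V) :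
    concatLetter K V (comul K V x) = x - counit K V x • 1 := by
  suffices h : concatLetter K V ∘ₗ comul K V =
      LinearMap.id - (LinearMap.toSpanSingleton K (TensorAlgebra K V) 1) ∘ₗ counit K V from
    LinearMap.congr_fun h x
  refine LinearMap.ext_on span_word ?_
  rintro _ ⟨l, rfl⟩
  rcases l with _ | ⟨v, l⟩
  · simp [word_nil, comul_one, concatLetter_tmul, ιInv_one, counit_one]
  · rw [LinearMap.comp_apply, comul_word, map_sum, Finset.sum_eq_single 1]
    · rw [concatLetter_tmul, List.take_succ_cons, List.take_zero, ιInv_word_cons, if_pos rfl]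
      simp [counit_ι_mul, word_cons]
    · intro i hi h1
      rcases i with _ | i
      · simp [concatLetter_tmul, word_nil, ιInv_one]
      · rw [List.take_succ_cons, concatLetter_tmul, ιInv_word_cons, if_neg, map_zero, zero_mul]
        rw [← List.length_eq_zero_iff, List.length_take]
        simp only [List.length_cons, Finset.mem_range] at hi
        lia
    · simp

end LetterProjection

/-! ### Filtration by length, and generation by the image -/

namespace CommProduct

variable {K : Type*} [Field K] {V : Type*} [AddCommGroup V] [Module K V] (P : CommProduct K V)

/-- The span of the words of length at most `n`. -/
def filtration (n : ℕ) : Submodule K P.Alg :=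
  Submodule.span K (P.algWord '' {l | l.length ≤ n})

theorem algWord_mem_filtration {l : List V} {n : ℕ} (h : l.length ≤ n) :
    P.algWord l ∈ P.filtration n :=
  Submodule.subset_span ⟨l, h, rfl⟩

theorem filtration_mono {m n : ℕ} (h : m ≤ n) : P.filtration m ≤ P.filtration n :=
  Submodule.span_mono (Set.image_mono fun _ hl => le_trans hl h)

theorem one_mem_filtration (n : ℕ) : (1 : P.Alg) ∈ P.filtration n := by
  rw [← P.algWord_nil]
  exact P.algWord_mem_filtration (by simp)

theorem filtration_zero : P.filtration 0 = Submodule.span K {1} := by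
  rw [filtration]
  congr 1
  ext x
  simp [← P.algWord_nil]

theorem ι_mul_mem_filtration (v : V) {n : ℕ} {x : TensorAlgebra K V}
    (hx : P.toAlg x ∈ P.filtration n) :
    P.toAlg (TensorAlgebra.ι K v * x) ∈ P.filtration (n + 1) := by
  have h : P.filtration n ≤ (P.filtration (n + 1)).comap (P.toAlg.toLinearMap ∘ₗ
      LinearMap.mulLeft K (TensorAlgebra.ι K v) ∘ₗ P.toAlg.symm.toLinearMap) := by
    refine Submodule.span_le.mpr ?_
    rintro _ ⟨l, hl, rfl⟩
    have hl' : l.length ≤ n := hl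
    have h1 : P.algWord (v :: l) ∈ P.filtration (n + 1) :=
      P.algWord_mem_filtration (by simpa using hl')
    rw [algWord, word_cons] at h1
    exact h1
  exact h hx

/-- The span of the tensors `a ⊗ b` with `b ∈ G`. -/
def rightTensors (G : Submodule K P.Alg) : Submodule K (P.Alg ⊗[K] P.Alg) :=
  Submodule.map₂ (TensorProduct.mk K P.Alg P.Alg) ⊤ G

variable {P} in
theorem tmul_mem_rightTensors {G : Submodule K P.Alg} (a : P.Alg) {b : P.Alg} (hb : b ∈ G) :
    a ⊗ₜ[K] b ∈ P.rightTensors G :=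
  Submodule.apply_mem_map₂ _ trivial hb

variable {P} in
theorem rightTensors_mul {G H L : Submodule K P.Alg} (h : ∀ x ∈ G, ∀ y ∈ H, x * y ∈ L)
    {X Y : P.Alg ⊗[K] P.Alg} (hX : X ∈ P.rightTensors G) (hY : Y ∈ P.rightTensors H) :
    X * Y ∈ P.rightTensors L := by
  have h1 : P.rightTensors G * P.rightTensors H ≤ P.rightTensors L := by
    rw [rightTensors, rightTensors, Submodule.map₂_eq_span_image2, Submodule.map₂_eq_span_image2,
      Submodule.span_mul_span, Submodule.span_le]
    rintro _ ⟨_, ⟨a, -, b, hb, rfl⟩, _, ⟨c, -, d, hd, rfl⟩, rfl⟩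
    simp only [TensorProduct.mk_apply, Algebra.TensorProduct.tmul_mul_tmul]
    exact tmul_mem_rightTensors _ (h b hb d hd)
  exact h1 (Submodule.mul_mem_mul hX hY)

/-- Every term of the deconcatenation other than `1 ⊗ x` removes at least one letter from the right
factor. -/
theorem comul_sub_mem {n : ℕ} {x : P.Alg} (hx : x ∈ P.filtration (n + 1)) :
    Coalgebra.comul (R := K) x - 1 ⊗ₜ[K] x ∈ P.rightTensors (P.filtration n) := by
  have h : P.filtration (n + 1) ≤ (P.rightTensors (P.filtration n)).comap
      (Coalgebra.comul (R := K) - TensorProduct.mk K P.Alg P.Alg 1) := by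
    refine Submodule.span_le.mpr ?_
    rintro _ ⟨l, hl, rfl⟩
    have hl' : l.length ≤ n + 1 := hl
    change Coalgebra.comul (R := K) (P.algWord l) - 1 ⊗ₜ[K] P.algWord l ∈
      P.rightTensors (P.filtration n)
    rw [comul_algWord, Finset.sum_range_succ']
    simp only [List.take_zero, List.drop_zero, algWord_nil, add_sub_cancel_right]
    refine Submodule.sum_mem _ fun i hi => tmul_mem_rightTensors _ (P.algWord_mem_filtration ?_)
    rw [List.length_drop]
    lia
  exact h hx

/-- `concatLetter` kills `1 ⊗ x`, recovers `x` up to a constant from its coproduct, and adds at most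
one letter to the right factor. -/
theorem mem_filtration_of_comul_sub_mem {n : ℕ} {x : P.Alg}
    (hx : Coalgebra.comul (R := K) x - 1 ⊗ₜ[K] x ∈ P.rightTensors (P.filtration n)) :
    x ∈ P.filtration (n + 1) := by
  have h : P.rightTensors (P.filtration n) ≤
      (P.filtration (n + 1)).comap (P.toAlg.toLinearMap ∘ₗ concatLetter K V) :=
    Submodule.map₂_le.mpr fun a _ b hb => P.ι_mul_mem_filtration _ hb
  obtain ⟨x, rfl⟩ := P.toAlg.surjective x
  have h1 : P.toAlg (concatLetter K V (comul K V x - 1 ⊗ₜ[K] x)) ∈ P.filtration (n + 1) := h hx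
  rw [map_sub, concatLetter_comul, concatLetter_tmul, ιInv_one, map_zero, zero_mul, sub_zero,
    map_sub, map_smul, toAlg_one] at h1
  have h2 := Submodule.add_mem _ h1
    (Submodule.smul_mem _ (counit K V x) (P.one_mem_filtration (n + 1)))
  rwa [sub_add_cancel] at h2

/-- A product compatible with the deconcatenation respects the filtration by the length of words. -/
theorem mul_mem_filtration {m n : ℕ} {x y : P.Alg} (hx : x ∈ P.filtration m)
    (hy : y ∈ P.filtration n) : x * y ∈ P.filtration (m + n) := by
  induction hN : m + n using Nat.strong_induction_on generalizing m n x y with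
  | _ N ih =>
    subst hN
    rcases m with _ | m
    · rw [filtration_zero] at hx
      obtain ⟨r, rfl⟩ := Submodule.mem_span_singleton.mp hx
      rw [smul_mul_assoc, _root_.one_mul, zero_add]
      exact Submodule.smul_mem _ _ hy
    rcases n with _ | n
    · rw [filtration_zero] at hy
      obtain ⟨r, rfl⟩ := Submodule.mem_span_singleton.mp hy
      rw [mul_smul_comm, _root_.mul_one, add_zero]
      exact Submodule.smul_mem _ _ hx
    refine P.mem_filtration_of_comul_sub_mem (n := m + 1 + n) ?_
    have hX := P.comul_sub_mem hx
    have hY := P.comul_sub_mem hy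
    -- Each term has at least one factor whose right side lost a letter, so the induction on `m + n`
    -- applies to the right tensor factors.
    have e : Coalgebra.comul (R := K) (x * y) - 1 ⊗ₜ[K] (x * y) =
        (Coalgebra.comul (R := K) x - 1 ⊗ₜ[K] x) * (1 ⊗ₜ[K] y) +
        (1 ⊗ₜ[K] x) * (Coalgebra.comul (R := K) y - 1 ⊗ₜ[K] y) +
        (Coalgebra.comul (R := K) x - 1 ⊗ₜ[K] x) * (Coalgebra.comul (R := K) y - 1 ⊗ₜ[K] y) := by
      have h1 : (1 : P.Alg) ⊗ₜ[K] (x * y) = (1 ⊗ₜ[K] x) * (1 ⊗ₜ[K] y) := by simp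
      rw [Bialgebra.comul_mul, h1]
      ring
    rw [e]
    refine Submodule.add_mem _ (Submodule.add_mem _ ?_ ?_) ?_
    · exact rightTensors_mul (fun a ha b hb => P.filtration_mono (by lia)
        (ih (m + (n + 1)) (by lia) ha hb rfl)) hX (tmul_mem_rightTensors _ hy)
    · exact rightTensors_mul (fun a ha b hb => P.filtration_mono (by lia)
        (ih (m + 1 + n) (by lia) ha hb rfl)) (tmul_mem_rightTensors _ hx) hY
    · exact rightTensors_mul (fun a ha b hb => P.filtration_mono (by lia)
        (ih (m + n) (by lia) ha hb rfl)) hX hY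

theorem reducedId_pow_algWord_mem (k : ℕ) (l : List V) :
    (reducedId K P.Alg ^ k) (P.algWord l) ∈ P.filtration l.length := by
  induction k generalizing l with
  | zero =>
    rw [pow_zero, LinearMap.convOne_apply, Algebra.algebraMap_eq_smul_one]
    exact Submodule.smul_mem _ _ (P.one_mem_filtration _)
  | succ k ih =>
    rw [pow_succ', convMul_algWord]
    refine Submodule.sum_mem _ fun i hi => ?_
    rcases eq_or_ne (l.take i) [] with h | h
    · rw [h, algWord_nil, reducedId_one, zero_mul]
      exact Submodule.zero_mem _
    · rw [reducedId_algWord _ h]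
      refine P.filtration_mono ?_ (P.mul_mem_filtration (P.algWord_mem_filtration le_rfl) (ih _))
      rw [← List.length_append, List.take_append_drop]

theorem series_mem_filtration (p : PowerSeries K) {n : ℕ} {x : P.Alg} (hx : x ∈ P.filtration n) :
    P.isLocallyNilpotent_reducedId.series p x ∈ P.filtration n := by
  have h : P.filtration n ≤
      (P.filtration n).comap (P.isLocallyNilpotent_reducedId.series p).ofConv := by
    refine Submodule.span_le.mpr ?_
    rintro _ ⟨l, hl, rfl⟩
    have hl' : l.length ≤ n := hl
    change P.isLocallyNilpotent_reducedId.series p (P.algWord l) ∈ P.filtration n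
    rw [P.isLocallyNilpotent_reducedId.series_apply (N := n + 1) _
      (fun m hm => P.convPow_algWord_eq_zero P.reducedId_one (by lia))]
    exact Submodule.sum_mem _ fun k _ => Submodule.smul_mem _ _
      (P.filtration_mono hl' (P.reducedId_pow_algWord_mem k l))
  exact h hx

theorem word_mem_component (l : List V) : word K l ∈ component K V l.length := by
  induction l with
  | nil =>
    rw [word_nil, component, List.length_nil, pow_zero]
    exact Submodule.one_le.mp le_rfl
  | cons v l ih =>
    rw [word_cons, component, List.length_cons, pow_succ']
    exact Submodule.mul_mem_mul ⟨v, rfl⟩ ih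

theorem component_le_filtration {n : ℕ} {x : TensorAlgebra K V} (hx : x ∈ component K V n) :
    P.toAlg x ∈ P.filtration n := by
  have h : component K V n ≤ (P.filtration n).comap P.toAlg.toLinearMap := by
    clear hx x
    induction n with
    | zero =>
      rw [component, pow_zero, Submodule.one_le]
      exact P.one_mem_filtration 0
    | succ n ih =>
      rw [component, pow_succ', Submodule.mul_le]
      rintro _ ⟨v, rfl⟩ x hx
      exact P.ι_mul_mem_filtration v (ih hx)
  exact h hx

theorem mem_iSup_component_of_mem_filtration {n : ℕ} {x : TensorAlgebra K V}
    (hx : P.toAlg x ∈ P.filtration n) (h0 : counit K V x = 0) :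
    x ∈ ⨆ k ∈ Set.Icc 1 n, component K V k := by
  set M := ⨆ k ∈ Set.Icc 1 n, component K V k with hM
  have hM0 : M ≤ LinearMap.ker (counit K V) := by
    refine iSup₂_le fun k hk => ?_
    obtain ⟨k, rfl⟩ := Nat.exists_eq_add_of_le' hk.1
    rw [component, pow_succ', Submodule.mul_le]
    rintro _ ⟨v, rfl⟩ y _
    exact counit_ι_mul v y
  have h : P.filtration n ≤
      (Submodule.span K {1} ⊔ M).comap P.toAlg.symm.toLinearMap := by
    refine Submodule.span_le.mpr ?_
    rintro _ ⟨l, hl, rfl⟩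
    have hl' : l.length ≤ n := hl
    change word K l ∈ Submodule.span K {1} ⊔ M
    rcases l with _ | ⟨v, l⟩
    · rw [word_nil]
      exact Submodule.mem_sup_left (Submodule.mem_span_singleton_self _)
    · refine Submodule.mem_sup_right ?_
      have h2 : component K V (v :: l).length ≤ M :=
        le_iSup₂_of_le (v :: l).length ⟨by simp, hl'⟩ le_rfl
      exact h2 (word_mem_component _)
  have hx' : x ∈ Submodule.span K {1} ⊔ M := h hx
  obtain ⟨y, hy, m, hm, rfl⟩ := Submodule.mem_sup.mp hx'
  obtain ⟨r, rfl⟩ := Submodule.mem_span_singleton.mp hy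
  have hm0 : counit K V m = 0 := hM0 hm
  rw [map_add, map_smul, counit_one, hm0, add_zero, smul_eq_mul, _root_.mul_one] at h0
  rwa [h0, zero_smul, zero_add]

/-- The range of the logarithm of the identity generates `(T(V), *)`. -/
theorem adjoin_log_eq_top (W : Submodule K P.Alg)
    (hW : ∀ x, P.isLocallyNilpotent_reducedId.series (logSeries K) x ∈ W) :
    Algebra.adjoin K (W : Set P.Alg) = ⊤ := by
  set S := Algebra.adjoin K (W : Set P.Alg) with hS
  have hpow : ∀ n : ℕ, (∀ l : List V, l.length < n → P.algWord l ∈ S) → ∀ (k : ℕ) (l : List V),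
      l.length < n → (reducedId K P.Alg ^ k) (P.algWord l) ∈ S := by
    intro n h k l hl
    rw [reducedId_pow_algWord]
    refine Subalgebra.sum_mem _ fun b hb => Subalgebra.list_prod_mem _ fun x hx => ?_
    obtain ⟨m, hm, rfl⟩ := List.mem_map.mp hx
    refine h m (lt_of_le_of_lt ?_ hl)
    have h1 := List.flatten_splitWrtCompositionAux (l := l) (mem_posLists.mp hb).2.1
    rw [← h1]
    exact (List.sublist_flatten_of_mem hm).length_le
  have hword : ∀ l : List V, P.algWord l ∈ S := by
    intro l
    induction hn : l.length using Nat.strong_induction_on generalizing l with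
    | _ n ih =>
      subst hn
      rcases eq_or_ne l [] with rfl | hl
      · rw [algWord_nil]
        exact Subalgebra.one_mem _
      have hlog : P.isLocallyNilpotent_reducedId.series (logSeries K) (P.algWord l) ∈ S :=
        Algebra.subset_adjoin (hW _)
      rw [P.isLocallyNilpotent_reducedId.series_apply (N := l.length + 2) _
        (fun m hm => P.convPow_algWord_eq_zero P.reducedId_one (by lia)), Finset.sum_range_succ',
        Finset.sum_range_succ'] at hlog
      simp only [logSeries, PowerSeries.coeff_mk, zero_add, tsub_self, pow_zero, pow_one,
        Nat.cast_one, div_one, one_smul, Nat.cast_zero, div_zero, zero_smul, add_zero] at hlog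
      rw [reducedId_algWord _ hl] at hlog
      -- The word is its logarithm minus the terms in `J ^ (k + 2)`. Cutting off a first piece, the
      -- cuts at both ends contribute `0`, and every other cut yields two strictly shorter words.
      refine (add_mem_cancel_left ?_).mp hlog
      refine Subalgebra.sum_mem _ fun k _ => Subalgebra.smul_mem _ ?_ _
      rw [pow_succ', convMul_algWord]
      refine Subalgebra.sum_mem _ fun i hi => ?_
      have hi' := Finset.mem_range_succ_iff.mp hi
      rcases Nat.eq_zero_or_pos i with rfl | h0
      · rw [List.take_zero, algWord_nil, reducedId_one, zero_mul]
        exact Subalgebra.zero_mem _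
      have hS' : (reducedId K P.Alg ^ (k + 1)) (P.algWord (l.drop i)) ∈ S :=
        hpow l.length (fun m hm => ih _ hm m rfl) _ _ (by
          rw [List.length_drop]
          have := List.length_pos_iff.mpr hl
          lia)
      rcases hi'.eq_or_lt with rfl | h1
      · rw [List.drop_length, P.convPow_algWord_eq_zero P.reducedId_one (by simp), mul_zero]
        exact Subalgebra.zero_mem _
      · refine Subalgebra.mul_mem _ ?_ hS'
        rw [reducedId_algWord _ (by rw [← List.length_pos_iff, List.length_take]; lia)]
        exact ih _ (by rw [List.length_take]; lia) _ rfl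
  rw [← Algebra.toSubmodule_eq_top, eq_top_iff, ← P.span_algWord, Submodule.span_le]
  rintro _ ⟨l, rfl⟩
  exact hword l

end CommProduct

end BInfinity

end

/-! ### Assembly of the theorem -/

theorem mainTheorem5 (K : Type*) [Field K] [CharZero K] (V : Type*) [AddCommGroup V] [Module K V]
    (P : BInfinity.CommProduct K V) :
    -- `e_*` is a projector
    P.canonicalIdempotent ∘ₗ P.canonicalIdempotent = P.canonicalIdempotent ∧
    -- it vanishes on `T₊(V) * T₊(V)`
    (∀ x ∈ P.augmentationSq, P.canonicalIdempotent x = 0) ∧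
    -- it is the identity on `V`
    (∀ v : V, P.canonicalIdempotent (TensorAlgebra.ι K v) = TensorAlgebra.ι K v) ∧
    -- it is a tangent to identity infinitesimal endomorphism
    P.IsTangentToIdentity P.canonicalIdempotent ∧
    -- its image freely generates `(T(V), *)` as a commutative algebra
    IsSymmetricAlgebra
      (P.toAlg.toLinearMap ∘ₗ (LinearMap.range P.canonicalIdempotent).subtype) ∧
    -- it maps `T_n(V)` into the sum of the `T_k(V)`, `1 ≤ k ≤ n`
    (∀ n : ℕ, Submodule.map P.canonicalIdempotent (BInfinity.component K V n) ≤
      ⨆ k ∈ Set.Icc 1 n, BInfinity.component K V k) := by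
  have hJ := P.isLocallyNilpotent_reducedId
  have he (x : TensorAlgebra K V) : P.canonicalIdempotent x =
      P.toAlg.symm (hJ.series (BInfinity.logSeries K) (P.toAlg x)) := by
    rw [P.canonicalIdempotent_eq_series]
    rfl
  have hproj (x : TensorAlgebra K V) :
      P.canonicalIdempotent (P.canonicalIdempotent x) = P.canonicalIdempotent x := by
    rw [he x, he, LinearEquiv.apply_symm_apply, BInfinity.log_log]
  have hsq : P.augmentationSq ≤ LinearMap.ker P.canonicalIdempotent := by
    refine Submodule.map₂_le.mpr fun x hx y hy => ?_
    rw [LinearMap.mem_ker, he, P.toAlg_mul, BInfinity.log_eq_zero_of_mem_sq, map_zero]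
    rw [pow_two]
    exact Ideal.mul_mem_mul hx hy
  have hprim (x : TensorAlgebra K V) (hx : x ∈ BInfinity.augmentation K V)
      (h : BInfinity.comul K V x - x ⊗ₜ[K] 1 - 1 ⊗ₜ[K] x = 0) : P.canonicalIdempotent x = x := by
    rw [sub_sub, sub_eq_zero] at h
    rw [he]
    exact BInfinity.log_eq_self_of_primitive hJ hx h
  refine ⟨LinearMap.ext hproj, hsq, fun v => hprim _ ?_ ?_, ⟨sup_le ?_ hsq, hprim⟩, ?_, ?_⟩
  · rw [BInfinity.augmentation, LinearMap.mem_ker, ← mul_one (TensorAlgebra.ι K v),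
      BInfinity.counit_ι_mul]
  · have h := BInfinity.comul_ι_mul (K := K) v 1
    rw [mul_one, BInfinity.comul_one] at h
    simp [h]
  · rw [Submodule.span_singleton_le_iff_mem]
    exact P.canonicalIdempotent_one
  · set W : Submodule K P.Alg := LinearMap.range P.canonicalIdempotent with hWdef
    have hW (x : P.Alg) : hJ.series (BInfinity.logSeries K) x ∈ W := ⟨x, he x⟩
    exact BInfinity.isSymmetricAlgebra_of_range_log hJ W hW
      (by rintro _ ⟨x, rfl⟩; exact (he _).symm.trans (hproj x))
      (fun g hg => P.isLocallyNilpotent hg) (P.adjoin_log_eq_top W hW)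
  · rintro n _ ⟨x, hx, rfl⟩
    refine P.mem_iSup_component_of_mem_filtration ?_ ?_
    · rw [he, LinearEquiv.apply_symm_apply]
      exact P.series_mem_filtration _ (P.component_le_filtration hx)
    · rw [he]
      -- The image has counit zero, since both `e_* - J` and `J` take values in the augmentation
      -- ideal; this excludes the component of degree `0`.
      have h1 := Ideal.pow_le_self two_ne_zero (BInfinity.log_sub_reducedId_mem hJ (P.toAlg x))
      have h2 := BInfinity.reducedId_pow_mem (K := K) 1 (P.toAlg x)
      rw [pow_one, pow_one] at h2
      have h3 := Ideal.add_mem _ h1 h2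
      rw [sub_add_cancel] at h3
      exact h3
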